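/- Let $2\le d_A<d_D$, let $A(\lambda)=\sum_{i=0}^{d_A}\lambda^iA_i$ with $A_i\in\mathbb C^{n\times n}$, $D(\lambda)=\sum_{i=0}^{d_D}\lambda^iD_i$ with $D_i\in\mathbb C^{m\times m}$, $B\in\mathbb C^{n\times m}$, $C\in\mathbb C^{m\times n}$, and $$\mathcal S(\lambda)=\left[\begin{array}{c|c}A(\lambda)&-B\\\hline C&D(\lambda)\end{array}\right].$$ For $1\le i\le d_A-1$ put $M_i=\operatorname{diag}\Big(I_{(d_A-i-1)n},\begin{bmatrix}-A_i&I_n\\I_n&0\end{bmatrix},I_{(i-1)n}\Big)$, and put $M_0=\operatorname{diag}(I_{(d_A-1)n},-A_0)$; define $N_0,\dots,N_{d_D-1}$ in the same way from $D_i$, $d_D$, $m$. With $e_k$ denoting unit vectors, the Fiedler matrices of $\mathcal S$ are $$\mathbb M_0=\left[\begin{array}{c|c}M_0&e_{d_A}e_{d_D}^T\otimes B\\\hline-e_{d_D}e_{d_A}^T\otimes C&N_0\end{array}\right],\qquad \mathbb M_i=\operatorname{diag}(M_i,N_i)\ (1\le i\le d_A-1),\qquad \mathbb M_i=\operatorname{diag}(I_{d_An},N_i)\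 (d_A\le i\le d_D-1).$$ Let $\sigma:\{0,\dots,d_D-1\}\to\{1,\dots,d_D\}$ be a bijection and $\mathbb M_\sigma:=\mathbb M_{\sigma^{-1}(1)}\mathbb M_{\sigma^{-1}(2)}\cdots\mathbb M_{\sigma^{-1}(d_D)}$. For $0\le i\le d_D-2$, $\sigma$ has a consecution at $i$ if $\sigma(i)<\sigma(i+1)$, and an inversion at $i$ otherwise. Define matrices $\mathbb W_0,\dots,\mathbb W_{d_D-2}$ recursively as follows. Each is partitioned as $\mathbb W_i=\left[\begin{array}{c|c}X_i&Y_i\\\hline Z_i&V_i\end{array}\right]$, where $X_i$, $Y_i$, $Z_i$, $V_i$ consist of blocks of size $n\times n$, $n\times m$, $m\times n$, $m\times m$, respectively; indices in parentheses count block rows and block columns within $X_i,Y_i,Z_i,V_i$, and $k{:}$ means "from the $k$-th to the last". Start: according as $\sigma$ has a consecution or an inversion at $0$, $$\mathbb W_0=\left[\begin{array}{cc|cc}-A_1&I_n&0&0\\-A_0&0&B&0\\\hline0&0&-D_1&I_m\\-C&0&-D_0&0\end{array}\right]\quad\text{or}\quad \mathbb W_0=\left[\begin{array}{cc|cc}-A_1&-A_0&0&B\\I_n&0&0&0\\\hline0&-C&-D_1&-D_0\\0&0&I_m&0\end{array}\right].$$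 First phase, $i=1,\dots,d_A-2$, writing $X,Y,Z,V$ for $X_{i-1},Y_{i-1},Z_{i-1},V_{i-1}$: according as $\sigma$ has a consecution or an inversion at $i$, $$\mathbb W_i=\left[\begin{array}{ccc|ccc}-A_{i+1}&I_n&0&0&0&0\\X(:,1)&0&X(:,2{:})&Y(:,1)&0&Y(:,2{:})\\\hline0&0&0&-D_{i+1}&I_m&0\\Z(:,1)&0&Z(:,2{:})&V(:,1)&0&V(:,2{:})\end{array}\right]\ \text{or}\ \mathbb W_i=\left[\begin{array}{cc|cc}-A_{i+1}&X(1,:)&0&Y(1,:)\\I_n&0&0&0\\0&X(2{:},:)&0&Y(2{:},:)\\\hline0&Z(1,:)&-D_{i+1}&V(1,:)\\0&0&I_m&0\\0&Z(2{:},:)&0&V(2{:},:)\end{array}\right].$$ Second phase, $i=d_A-1,\dots,d_D-2$, in which only $D$-blocks are inserted: according as $\sigma$ has a consecution or an inversion at $i$, $$\mathbb W_i=\left[\begin{array}{c|ccc}X&Y(:,1)&0&Y(:,2{:})\\\hline0&-D_{i+1}&I_m&0\\Z&V(:,1)&0&V(:,2{:})\end{array}\right]\quad\text{or}\quad\mathbb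 W_i=\left[\begin{array}{c|cc}X&0&Y\\\hline Z(1,:)&-D_{i+1}&V(1,:)\\0&I_m&0\\Z(2{:},:)&0&V(2{:},:)\end{array}\right].$$ Then, for $0\le i\le d_D-2$, $\mathbb W_i$ has $\min(i+2,d_A)$ block rows and columns in the $A$-part and $i+2$ in the $D$-part; for $1\le i\le d_D-2$, the blocks of $\mathbb W_{i-1}$ are blocks of $\mathbb W_i$ (more precisely, $\mathbb W_{i-1}$ is obtained from $\mathbb W_i$ by selecting, in order, block rows and block columns in the $A$-part and in the $D$-part); and $$\mathbb W_{d_D-2}=\mathbb M_\sigma .$$ -/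

import Mathlib

open scoped Kronecker

noncomputable section

/-- The system polynomial `S(λ) = [A(λ), -B; C, D(λ)]`, with `A(λ) = ∑_{i ≤ dA} λ^i A_i` of size
`n × n`, `D(λ) = ∑_{j ≤ dD} λ^j D_j` of size `m × m`, and constant `B`, `C`. -/
structure SystemPolynomial (n m dA dD : ℕ) where
  A : Polynomial (Matrix (Fin n) (Fin n) ℂ)
  D : Polynomial (Matrix (Fin m) (Fin m) ℂ)
  B : Matrix (Fin n) (Fin m) ℂ
  C : Matrix (Fin m) (Fin n) ℂ
  natDegree_A_le : A.natDegree ≤ dA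
  natDegree_D_le : D.natDegree ≤ dD

/-- The Fiedler matrices `M_0, …, M_d` of `∑_{i ≤ d} λ^i P_i`, described block by block (block
rows and columns are counted from `0`):
* `M_0 = diag(I_{(d-1)k}, -P_0)`,
* `M_d = diag(P_d, I_{(d-1)k})`,
* `M_i = diag(I_{(d-i-1)k}, [-P_i, I; I, 0], I_{(i-1)k})` for `1 ≤ i ≤ d - 1`. -/
def fiedlerMatrix {k : ℕ} (d : ℕ) (P : ℕ → Matrix (Fin k) (Fin k) ℂ) (i : ℕ) :
    Matrix (Fin d × Fin k) (Fin d × Fin k) ℂ :=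
  Matrix.comp (Fin d) (Fin d) (Fin k) (Fin k) ℂ <| Matrix.of fun p q =>
    if i = 0 then
      if p = q then (if (p : ℕ) + 1 = d then -P 0 else 1) else 0
    else if i = d then
      if p = q then (if (p : ℕ) = 0 then P d else 1) else 0
    else
      if (p : ℕ) + i + 1 = d ∧ (q : ℕ) + i + 1 = d then -P i
      else if (p : ℕ) + i + 1 = d ∧ (q : ℕ) + i = d then 1
      else if (p : ℕ) + i = d ∧ (q : ℕ) + i + 1 = d then 1
      else if (p : ℕ) + i = d ∧ (q : ℕ) + i = d then 0
      else if p = q then 1 else 0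

/-- The matrix `e_a e_d^T` (last unit vector times transposed last unit vector), of size `a × d`. -/
def lastUnit (a d : ℕ) : Matrix (Fin a) (Fin d) ℂ :=
  Matrix.of fun p q => if (p : ℕ) + 1 = a ∧ (q : ℕ) + 1 = d then 1 else 0

/-- The Fiedler matrices `𝕄_0, …, 𝕄_d`, `d = max dA dD`, of a system polynomial. -/
def SystemPolynomial.fiedler {n m dA dD : ℕ} (S : SystemPolynomial n m dA dD) (i : ℕ) :
    Matrix ((Fin dA × Fin n) ⊕ (Fin dD × Fin m)) ((Fin dA × Fin n) ⊕ (Fin dD × Fin m)) ℂ :=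
  if i = 0 then
    Matrix.fromBlocks (fiedlerMatrix dA S.A.coeff 0) (lastUnit dA dD ⊗ₖ S.B)
      (-(lastUnit dD dA ⊗ₖ S.C)) (fiedlerMatrix dD S.D.coeff 0)
  else if i = max dA dD then
    Matrix.fromBlocks (fiedlerMatrix dA S.A.coeff dA) 0 0 (fiedlerMatrix dD S.D.coeff dD)
  else
    Matrix.fromBlocks (if i < dA then fiedlerMatrix dA S.A.coeff i else 1) 0
      0 (if i < dD then fiedlerMatrix dD S.D.coeff i else 1)

/-- `𝕄_σ = 𝕄_{σ⁻¹(1)} 𝕄_{σ⁻¹(2)} ⋯ 𝕄_{σ⁻¹(d)}`. Positions in the product are counted from `0`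
here, so that a bijection `{0, …, d-1} → {1, …, d}` becomes a permutation of `Fin d`. -/
def SystemPolynomial.fiedlerProduct {n m dA dD d : ℕ} (S : SystemPolynomial n m dA dD)
    (σ : Equiv.Perm (Fin d)) :
    Matrix ((Fin dA × Fin n) ⊕ (Fin dD × Fin m)) ((Fin dA × Fin n) ⊕ (Fin dD × Fin m)) ℂ :=
  (List.ofFn fun k : Fin d => S.fiedler (σ.symm k : ℕ)).prod

/-- `σ` has a consecution at `j` if `σ(j) < σ(j+1)`; otherwise, for `j + 1 < d`, it has an
inversion at `j`. -/
def HasConsecution {d : ℕ} (σ : Equiv.Perm (Fin d)) (j : ℕ) : Prop :=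
  ∃ h : j + 1 < d, σ ⟨j, Nat.lt_of_succ_lt h⟩ < σ ⟨j + 1, h⟩

/-- A matrix partitioned into `a + d` block rows and columns: `a` of size `n` (the `A` part),
followed by `d` of size `m` (the `D` part). -/
structure BlockMatrix (n m a d : ℕ) where
  AA : Matrix (Fin a) (Fin a) (Matrix (Fin n) (Fin n) ℂ)
  AD : Matrix (Fin a) (Fin d) (Matrix (Fin n) (Fin m) ℂ)
  DA : Matrix (Fin d) (Fin a) (Matrix (Fin m) (Fin n) ℂ)
  DD : Matrix (Fin d) (Fin d) (Matrix (Fin m) (Fin m) ℂ)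

/-- The underlying matrix, forgetting the partition. -/
def BlockMatrix.toMatrix {n m a d : ℕ} (W : BlockMatrix n m a d) :
    Matrix ((Fin a × Fin n) ⊕ (Fin d × Fin m)) ((Fin a × Fin n) ⊕ (Fin d × Fin m)) ℂ :=
  Matrix.fromBlocks
    (Matrix.comp _ _ _ _ ℂ W.AA) (Matrix.comp _ _ _ _ ℂ W.AD)
    (Matrix.comp _ _ _ _ ℂ W.DA) (Matrix.comp _ _ _ _ ℂ W.DD)

/-- A block matrix together with its numbers of blocks. -/
structure PartitionedMatrix (n m : ℕ) where
  a : ℕ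
  d : ℕ
  blocks : BlockMatrix n m a d

/-- The blocks of `U` are blocks of `V`: `U` arises from `V` by selecting block rows and block
columns, in order, from the `A` part and from the `D` part. -/
def PartitionedMatrix.BlocksIn {n m : ℕ} (U V : PartitionedMatrix n m) : Prop :=
  ∃ (rA cA : Fin U.a ↪o Fin V.a) (rD cD : Fin U.d ↪o Fin V.d),
    (∀ p q, U.blocks.AA p q = V.blocks.AA (rA p) (cA q)) ∧
    (∀ p q, U.blocks.AD p q = V.blocks.AD (rA p) (cD q)) ∧
    (∀ p q, U.blocks.DA p q = V.blocks.DA (rD p) (cA q)) ∧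
    (∀ p q, U.blocks.DD p q = V.blocks.DD (rD p) (cD q))

/-- `(v_1, v_2, …, v_{k+1}) ↦ (v_1, x, v_2, …, v_{k+1})`. -/
def insertSecond {α : Type} {k : ℕ} (x : α) (v : Fin (k + 1) → α) : Fin (k + 2) → α :=
  Matrix.vecCons (v 0) (Matrix.vecCons x (Matrix.vecTail v))

/-- `[-P, I, 0; W(:,1), 0, W(:,2:)]`. -/
def bordered_consecution {k b : ℕ} (P : Matrix (Fin k) (Fin k) ℂ)
    (W : Matrix (Fin (b + 1)) (Fin (b + 1)) (Matrix (Fin k) (Fin k) ℂ)) :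
    Matrix (Fin (b + 2)) (Fin (b + 2)) (Matrix (Fin k) (Fin k) ℂ) :=
  Matrix.of (Matrix.vecCons (Matrix.vecCons (-P) (Matrix.vecCons 1 0))
    fun p => insertSecond 0 (W p))

/-- `[-P, W(1,:); I, 0; 0, W(2:,:)]`. -/
def bordered_inversion {k b : ℕ} (P : Matrix (Fin k) (Fin k) ℂ)
    (W : Matrix (Fin (b + 1)) (Fin (b + 1)) (Matrix (Fin k) (Fin k) ℂ)) :
    Matrix (Fin (b + 2)) (Fin (b + 2)) (Matrix (Fin k) (Fin k) ℂ) :=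
  Matrix.of (Matrix.vecCons (Matrix.vecCons (-P) (W 0))
    (Matrix.vecCons (Matrix.vecCons 1 0) fun p => Matrix.vecCons 0 (W p.succ)))

/-- First phase, consecution: both an `A` block and a `D` block are inserted. -/
def BlockMatrix.bothConsecution {n m a d : ℕ} (P : Matrix (Fin n) (Fin n) ℂ)
    (Q : Matrix (Fin m) (Fin m) ℂ) (W : BlockMatrix n m (a + 1) (d + 1)) :
    BlockMatrix n m (a + 2) (d + 2) where
  AA := bordered_consecution P W.AA
  AD := Matrix.of (Matrix.vecCons 0 fun p => insertSecond 0 (W.AD p))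
  DA := Matrix.of (Matrix.vecCons 0 fun p => insertSecond 0 (W.DA p))
  DD := bordered_consecution Q W.DD

/-- First phase, inversion: both an `A` block and a `D` block are inserted. -/
def BlockMatrix.bothInversion {n m a d : ℕ} (P : Matrix (Fin n) (Fin n) ℂ)
    (Q : Matrix (Fin m) (Fin m) ℂ) (W : BlockMatrix n m (a + 1) (d + 1)) :
    BlockMatrix n m (a + 2) (d + 2) where
  AA := bordered_inversion P W.AA
  AD := Matrix.of (insertSecond 0 fun p => Matrix.vecCons 0 (W.AD p))
  DA := Matrix.of (insertSecond 0 fun p => Matrix.vecCons 0 (W.DA p))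
  DD := bordered_inversion Q W.DD

/-- Second phase, consecution: only a `D` block is inserted. -/
def BlockMatrix.onlyDConsecution {n m a d : ℕ} (Q : Matrix (Fin m) (Fin m) ℂ)
    (W : BlockMatrix n m a (d + 1)) : BlockMatrix n m a (d + 2) where
  AA := W.AA
  AD := Matrix.of fun p => insertSecond 0 (W.AD p)
  DA := Matrix.of (Matrix.vecCons 0 W.DA)
  DD := bordered_consecution Q W.DD

/-- Second phase, inversion: only a `D` block is inserted. -/
def BlockMatrix.onlyDInversion {n m a d : ℕ} (Q : Matrix (Fin m) (Fin m) ℂ)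
    (W : BlockMatrix n m a (d + 1)) : BlockMatrix n m a (d + 2) where
  AA := W.AA
  AD := Matrix.of fun p => Matrix.vecCons 0 (W.AD p)
  DA := Matrix.of (insertSecond 0 W.DA)
  DD := bordered_inversion Q W.DD

open Classical in
/-- A step of the first phase. (The last case, an empty `A` or `D` part, does not occur.) -/
def phaseOneStep {n m : ℕ} (P : Matrix (Fin n) (Fin n) ℂ) (Q : Matrix (Fin m) (Fin m) ℂ)
    (consecution : Prop) : PartitionedMatrix n m → PartitionedMatrix n m
  | ⟨a + 1, d + 1, W⟩ =>
    ⟨a + 2, d + 2, if consecution then W.bothConsecution P Q else W.bothInversion P Q⟩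
  | W => W

open Classical in
/-- A step of the second phase. (The last case, an empty `D` part, does not occur.) -/
def phaseTwoStep {n m : ℕ} (Q : Matrix (Fin m) (Fin m) ℂ)
    (consecution : Prop) : PartitionedMatrix n m → PartitionedMatrix n m
  | ⟨a, d + 1, W⟩ =>
    ⟨a, d + 2, if consecution then W.onlyDConsecution Q else W.onlyDInversion Q⟩
  | W => W

/-- The first matrix if `σ` has a consecution at `0`. -/
def SystemPolynomial.startConsecution {n m dA dD : ℕ} (S : SystemPolynomial n m dA dD) :
    BlockMatrix n m 2 2 where
  AA := !![-S.A.coeff 1, 1; -S.A.coeff 0, 0]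
  AD := !![0, 0; S.B, 0]
  DA := !![0, 0; -S.C, 0]
  DD := !![-S.D.coeff 1, 1; -S.D.coeff 0, 0]

/-- The first matrix if `σ` has an inversion at `0`. -/
def SystemPolynomial.startInversion {n m dA dD : ℕ} (S : SystemPolynomial n m dA dD) :
    BlockMatrix n m 2 2 where
  AA := !![-S.A.coeff 1, -S.A.coeff 0; 1, 0]
  AD := !![0, S.B; 0, 0]
  DA := !![0, -S.C; 0, 0]
  DD := !![-S.D.coeff 1, -S.D.coeff 0; 1, 0]

open Classical in
/-- The sequence `𝕎_0, 𝕎_1, …` of the algorithm for `2 ≤ dA < dD`: the first phase consists of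
the steps `i = 1, …, dA - 2`, the second one of the steps `i = dA - 1, …, dD - 2`. -/
def SystemPolynomial.algorithm {n m dA dD : ℕ} (S : SystemPolynomial n m dA dD)
    (σ : Equiv.Perm (Fin dD)) : ℕ → PartitionedMatrix n m
  | 0 => ⟨2, 2, if HasConsecution σ 0 then S.startConsecution else S.startInversion⟩
  | i + 1 =>
    if (i + 1) + 2 ≤ dA then
      phaseOneStep (S.A.coeff (i + 2)) (S.D.coeff (i + 2)) (HasConsecution σ (i + 1))
        (S.algorithm σ i)
    else
      phaseTwoStep (S.D.coeff (i + 2)) (HasConsecution σ (i + 1)) (S.algorithm σ i)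

end

/-! Number the blocks of each part from the last one upwards. The Fiedler matrix of index `i` then
differs from the identity only in levels `i - 1` and `i`, and `B`, `C` join the two parts only at
level `0`. Hence factors with non-adjacent indices commute, and the product depends only on the
relative order of neighbouring factors: it can be built up from index `0`, the next factor going to
the right at a consecution and to the left at an inversion (`prod_ofFn_perm_eq_orderedProd`,
`commute_systemFiedler`).

Counting from the end also makes the factors stable: enlarging a part only puts an identity block in
front of every old factor, so the old partial product `W` becomes `diag(I, W)` up to reindexing
(`orderedProd_submatrix`). The next factor has the largest index allowed by the new size. Its block
`[-P, I; I, 0]` stands in the top left corner, and multiplying `diag(I, W)` by it from the right or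
left gives exactly the bordering of the algorithm (`comp_bordered_consecution`,
`comp_bordered_inversion`). In the second phase the `A` part of the new factor is the identity.
Induction yields each matrix of the algorithm as a partial product for a system truncated to the
current size. -/

noncomputable section

/-! ### Products determined by consecutions and inversions -/

open Classical in
/-- The product of `M 0, …, M k` in which `M (j + 1)` is multiplied from the right if `c j` holds,
and from the left otherwise. -/
def orderedProd {G : Type*} [Monoid G] (M : ℕ → G) (c : ℕ → Prop) : ℕ → G
  | 0 => M 0
  | k + 1 => if c k then orderedProd M c k * M (k + 1) else M (k + 1) * orderedProd M c k

theorem orderedProd_congr {G : Type*} [Monoid G] {M M' : ℕ → G} {c c' : ℕ → Prop} {k : ℕ}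
    (hM : ∀ j ≤ k, M j = M' j) (hc : ∀ j < k, c j ↔ c' j) :
    orderedProd M c k = orderedProd M' c' k := by
  induction k with
  | zero => exact hM 0 le_rfl
  | succ k ih =>
    simp only [orderedProd]
    rw [ih (fun j hj => hM j (by omega)) (fun j hj => hc j (by omega)), hM (k + 1) le_rfl,
      propext (hc k (by omega))]

/-- A product of factors, sorted by `s`, in which factors with non-adjacent indices commute. -/
theorem prod_map_eq_orderedProd {G : Type*} [Monoid G] (M : ℕ → G) (s : ℕ → ℕ) (k : ℕ) (l : List ℕ)
    (hM : ∀ i j, i + 2 ≤ j → j ≤ k → Commute (M i) (M j))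
    (hs : l.Pairwise fun x y => s x < s y) (hl : ∀ x, x ∈ l ↔ x ≤ k) :
    (l.map M).prod = orderedProd M (fun j => s j < s (j + 1)) k := by
  induction k generalizing l with
  | zero =>
    cases l with
    | nil => simpa using hl 0
    | cons x l =>
      obtain rfl : x = 0 := by simpa using hl x
      cases l with
      | nil => simp [orderedProd]
      | cons y l =>
        obtain rfl : y = 0 := by simpa using hl y
        simp at hs
  | succ k ih =>
    -- Take out the largest index `k + 1`. Its factor commutes with all others except possibly `M
    -- k`, so it can be moved past whichever side does not contain `k`.
    obtain ⟨l₁, l₂, rfl⟩ := List.append_of_mem ((hl (k + 1)).2 le_rfl)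
    rw [List.pairwise_append, List.pairwise_cons] at hs
    obtain ⟨h₁, ⟨h₂, h₃⟩, h₄⟩ := hs
    have h₅ : ∀ x ∈ l₁, s x < s (k + 1) := fun x hx => h₄ x hx _ (by simp)
    have hmem : ∀ x, x ∈ l₁ ++ l₂ ↔ x ≤ k := by
      intro x
      have hx := hl x
      simp only [List.mem_append, List.mem_cons] at hx ⊢
      constructor
      · intro h
        -- Strict sorting by `s` excludes a second occurrence of `k + 1`.
        have hne : x ≠ k + 1 := by
          rintro rfl
          rcases h with h | h
          · exact lt_irrefl _ (h₅ _ h)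
          · exact lt_irrefl _ (h₂ _ h)
        have := hx.1 (h.imp_right Or.inr)
        omega
      · intro h
        rcases hx.2 (by omega) with h' | h' | h'
        · exact Or.inl h'
        · omega
        · exact Or.inr h'
    have hrec := ih (l₁ ++ l₂) (fun i j h h' => hM i j h (by omega))
      (List.pairwise_append.2 ⟨h₁, h₃, fun x hx y hy => h₄ x hx y (by simp [hy])⟩) hmem
    have hcomm : ∀ t : List ℕ, (∀ x ∈ t, x ≤ k ∧ x ≠ k) →
        Commute (t.map M).prod (M (k + 1)) := by
      intro t ht
      apply Commute.list_prod_left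
      intro y hy
      obtain ⟨x, hx, rfl⟩ := List.mem_map.1 hy
      have := ht x hx
      exact hM x (k + 1) (by omega) le_rfl
    simp only [orderedProd]
    rw [← hrec]
    split_ifs with h
    · have := hcomm l₂ fun x hx => ⟨(hmem x).1 (by simp [hx]), by
        rintro rfl; exact absurd (h₂ _ hx) (by omega)⟩
      simp only [List.map_append, List.map_cons, List.prod_append, List.prod_cons, mul_assoc,
        this.eq]
    · have := hcomm l₁ fun x hx => ⟨(hmem x).1 (by simp [hx]), by
        rintro rfl; exact h (h₅ _ hx)⟩
      simp only [List.map_append, List.map_cons, List.prod_append, List.prod_cons]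
      rw [← mul_assoc, this.eq, mul_assoc]

theorem prod_ofFn_perm_eq_orderedProd {G : Type*} [Monoid G] {d : ℕ} (M : ℕ → G)
    (σ : Equiv.Perm (Fin (d + 1)))
    (hM : ∀ i j, i + 2 ≤ j → j ≤ d → Commute (M i) (M j)) :
    (List.ofFn fun k => M (σ.symm k : ℕ)).prod = orderedProd M (HasConsecution σ) d := by
  -- The value `0` outside the domain of `σ` is never used: only indices up to `d` are compared.
  let s : ℕ → ℕ := fun j => if h : j < d + 1 then σ ⟨j, h⟩ else 0
  have hs : ∀ x : Fin (d + 1), s (σ.symm x) = x := fun x => by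
    simp only [s, dif_pos (σ.symm x).2, Fin.eta, Equiv.apply_symm_apply]
  have key := prod_map_eq_orderedProd M s d (List.ofFn fun k => (σ.symm k : ℕ)) hM
    (by
      rw [List.pairwise_ofFn]
      intro i j hij
      rw [hs, hs]
      exact hij)
    (by
      intro x
      rw [List.mem_ofFn]
      constructor
      · rintro ⟨k, rfl⟩
        exact Nat.lt_succ_iff.1 (σ.symm k).2
      · intro hx
        exact ⟨σ ⟨x, Nat.lt_succ_of_le hx⟩, by simp⟩)
  rw [List.map_ofFn] at key
  refine key.trans (orderedProd_congr (fun _ _ => rfl) fun j hj => ?_)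
  have h₁ : j < d + 1 := by omega
  have h₂ : j + 1 < d + 1 := by omega
  simp only [s, HasConsecution, dif_pos h₁, dif_pos h₂, exists_prop_of_true h₂, Fin.lt_def]

/-! ### Commutation of Fiedler matrices with non-adjacent indices -/

/-- Two square matrices that differ from the identity only on disjoint sets of indices commute. -/
theorem Matrix.commute_of_support {ι R α : Type*} [Fintype ι] [DecidableEq ι] [CommRing R]
    (f : ι → α) (T U : Set α) (hTU : Disjoint T U) (M N : Matrix ι ι R)
    (hM : ∀ x y, ¬ (f x ∈ T ∧ f y ∈ T) → M x y = (1 : Matrix ι ι R) x y)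
    (hN : ∀ x y, ¬ (f x ∈ U ∧ f y ∈ U) → N x y = (1 : Matrix ι ι R) x y) : Commute M N := by
  have key : ∀ (M N : Matrix ι ι R) (T U : Set α), Disjoint T U →
      (∀ x y, ¬ (f x ∈ T ∧ f y ∈ T) → M x y = (1 : Matrix ι ι R) x y) →
      (∀ x y, ¬ (f x ∈ U ∧ f y ∈ U) → N x y = (1 : Matrix ι ι R) x y) →
      -- The nonzero columns of `M - 1` lie over `T` and the nonzero rows of `N - 1` over `U`, so no
      -- summation index contributes. By symmetry the reversed product vanishes too, hence `M - 1`
      -- and `N - 1` commute.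
      (M - 1) * (N - 1) = 0 := by
    intro M N T U hTU hM hN
    ext x z
    rw [Matrix.mul_apply, Matrix.zero_apply]
    refine Finset.sum_eq_zero fun y _ => ?_
    by_cases hy : f y ∈ T
    · rw [Matrix.sub_apply N, hN y z fun h => Set.disjoint_left.1 hTU hy h.1, sub_self, mul_zero]
    · rw [Matrix.sub_apply M, hM x y fun h => hy h.2, sub_self, zero_mul]
  have h₁ := key M N T U hTU hM hN
  have h₂ := key N M U T hTU.symm hN hM
  have h₃ : Commute (M - 1) (N - 1) := h₁.trans h₂.symm
  simpa using (h₃.add_right (Commute.one_right _)).add_left (Commute.one_left _)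

/-- The Fiedler matrices with index below `max a d` of a system with `a` and `d` blocks. -/
def systemFiedler {n m : ℕ} (A : ℕ → Matrix (Fin n) (Fin n) ℂ) (D : ℕ → Matrix (Fin m) (Fin m) ℂ)
    (B : Matrix (Fin n) (Fin m) ℂ) (C : Matrix (Fin m) (Fin n) ℂ) (a d i : ℕ) :
    Matrix ((Fin a × Fin n) ⊕ (Fin d × Fin m)) ((Fin a × Fin n) ⊕ (Fin d × Fin m)) ℂ :=
  if i = 0 then
    Matrix.fromBlocks (fiedlerMatrix a A 0) (lastUnit a d ⊗ₖ B)
      (-(lastUnit d a ⊗ₖ C)) (fiedlerMatrix d D 0)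
  else
    Matrix.fromBlocks (if i < a then fiedlerMatrix a A i else 1) 0
      0 (if i < d then fiedlerMatrix d D i else 1)

theorem fiedlerMatrix_apply_of_not_mem {k d i : ℕ} (P : ℕ → Matrix (Fin k) (Fin k) ℂ) (hi : i < d)
    (p q : Fin d × Fin k)
    (h : ¬ ((d - 1 - (p.1 : ℕ) = i ∨ d - 1 - (p.1 : ℕ) + 1 = i) ∧
      (d - 1 - (q.1 : ℕ) = i ∨ d - 1 - (q.1 : ℕ) + 1 = i))) :
    fiedlerMatrix d P i p q = (1 : Matrix (Fin d × Fin k) (Fin d × Fin k) ℂ) p q := by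
  obtain ⟨p, x⟩ := p
  obtain ⟨q, y⟩ := q
  obtain ⟨p, hp⟩ := p
  obtain ⟨q, hq⟩ := q
  simp only at h
  simp only [fiedlerMatrix, Matrix.comp_apply, Matrix.of_apply, Matrix.one_apply, Prod.mk.injEq,
    Fin.mk.injEq]
  have h₀ : i ≠ d := by omega
  simp only [h₀, if_false]
  split_ifs <;> first | omega | simp_all [Matrix.one_apply]

/-- The distance of a block index from the last one. -/
def blockLevel {n m a d : ℕ} : (Fin a × Fin n) ⊕ (Fin d × Fin m) → ℕ
  | .inl p => a - 1 - p.1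
  | .inr p => d - 1 - p.1

/-- Measuring levels from the last block gives both parts a common label although their sizes
differ; the coupling blocks `B` and `C` of the factor of index `0` then stay within level `0`. -/
theorem systemFiedler_apply_of_not_mem {n m : ℕ} (A : ℕ → Matrix (Fin n) (Fin n) ℂ)
    (D : ℕ → Matrix (Fin m) (Fin m) ℂ) (B : Matrix (Fin n) (Fin m) ℂ)
    (C : Matrix (Fin m) (Fin n) ℂ) (a d i : ℕ) (x y : (Fin a × Fin n) ⊕ (Fin d × Fin m))
    (h : ¬ (blockLevel x ∈ {j | j = i ∨ j + 1 = i} ∧ blockLevel y ∈ {j | j = i ∨ j + 1 = i})) :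
    systemFiedler A D B C a d i x y = (1 : Matrix _ _ ℂ) x y := by
  simp only [Set.mem_ofPred_eq] at h
  unfold systemFiedler
  split_ifs with h₀ ha hd hd
  · subst h₀
    rcases x with x | x <;> rcases y with y | y
    · have := x.1.2
      simpa [Matrix.one_apply] using fiedlerMatrix_apply_of_not_mem A (by omega) x y h
    · obtain ⟨⟨p, hp⟩, x⟩ := x
      obtain ⟨⟨q, hq⟩, y⟩ := y
      simp only [blockLevel] at h
      have : ¬ (p + 1 = a ∧ q + 1 = d) := by omega
      simp [lastUnit, this]
    · obtain ⟨⟨p, hp⟩, x⟩ := x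
      obtain ⟨⟨q, hq⟩, y⟩ := y
      simp only [blockLevel] at h
      have : ¬ (p + 1 = d ∧ q + 1 = a) := by omega
      simp [lastUnit, this]
    · have := x.1.2
      simpa [Matrix.one_apply] using fiedlerMatrix_apply_of_not_mem D (by omega) x y h
  all_goals
    rcases x with x | x <;> rcases y with y | y <;> try (simp; done)
    all_goals first
      | simpa [Matrix.one_apply] using fiedlerMatrix_apply_of_not_mem A ‹_› x y h
      | simpa [Matrix.one_apply] using fiedlerMatrix_apply_of_not_mem D ‹_› x y h

theorem commute_systemFiedler {n m : ℕ} (A : ℕ → Matrix (Fin n) (Fin n) ℂ)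
    (D : ℕ → Matrix (Fin m) (Fin m) ℂ) (B : Matrix (Fin n) (Fin m) ℂ)
    (C : Matrix (Fin m) (Fin n) ℂ) (a d i j : ℕ) (h : i + 2 ≤ j) :
    Commute (systemFiedler A D B C a d i) (systemFiedler A D B C a d j) := by
  refine Matrix.commute_of_support blockLevel {l | l = i ∨ l + 1 = i} {l | l = j ∨ l + 1 = j} ?_
    _ _ (systemFiedler_apply_of_not_mem A D B C a d i) (systemFiedler_apply_of_not_mem A D B C a d j)
  rw [Set.disjoint_left]
  rintro l (hl | hl) (hl' | hl') <;> omega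

theorem SystemPolynomial.fiedler_eq_systemFiedler {n m dA dD : ℕ} (S : SystemPolynomial n m dA dD)
    (hAD : dA < dD) (i : ℕ) (hi : i < dD) :
    S.fiedler i = systemFiedler S.A.coeff S.D.coeff S.B S.C dA dD i := by
  unfold SystemPolynomial.fiedler systemFiedler
  have : i ≠ max dA dD := by omega
  simp [this]

theorem SystemPolynomial.fiedlerProduct_eq_orderedProd {n m dA d : ℕ}
    (S : SystemPolynomial n m dA (d + 1)) (hAD : dA < d + 1) (σ : Equiv.Perm (Fin (d + 1))) :
    S.fiedlerProduct σ =
      orderedProd (systemFiedler S.A.coeff S.D.coeff S.B S.C dA (d + 1)) (HasConsecution σ) d := by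
  rw [← prod_ofFn_perm_eq_orderedProd _ σ fun i j h _ => commute_systemFiedler _ _ _ _ _ _ i j h]
  unfold SystemPolynomial.fiedlerProduct
  congr 2
  funext k
  exact S.fiedler_eq_systemFiedler hAD _ (σ.symm k).2

/-! ### Splitting off identity blocks -/

/-- The position of the nontrivial block is fixed relative to the end, so the extra block appears in
front, as an identity. -/
theorem fiedlerMatrix_succ {k d i : ℕ} (P : ℕ → Matrix (Fin k) (Fin k) ℂ) (hi : i < d) :
    fiedlerMatrix (d + 1) P i = Matrix.comp _ _ _ _ ℂ (Matrix.of
      (Matrix.vecCons (Matrix.vecCons 1 0) fun p => Matrix.vecCons 0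
        ((Matrix.comp _ _ _ _ ℂ).symm (fiedlerMatrix d P i) p))) := by
  ext ⟨p, x⟩ ⟨q, y⟩
  have h₁ : i ≠ d + 1 := by omega
  have h₂ : i ≠ d := by omega
  have h₃ : d ≠ 0 := by omega
  have h₄ : i + 1 ≠ d + 1 := by omega
  cases p using Fin.cases <;> cases q using Fin.cases <;>
    simp [-Matrix.cons_val, fiedlerMatrix, h₁, h₂, h₃.symm, Fin.ext_iff, add_right_comm _ 1 i]

theorem lastUnit_succ_succ {a d : ℕ} (ha : 0 < a) (hd : 0 < d) :
    lastUnit (a + 1) (d + 1) =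
      Matrix.of (Matrix.vecCons 0 fun p => Matrix.vecCons 0 (lastUnit a d p)) := by
  ext p q
  cases p using Fin.cases <;> cases q using Fin.cases <;>
    simp [-Matrix.cons_val, lastUnit, ha.ne, hd.ne]

theorem lastUnit_succ_right {a d : ℕ} (hd : 0 < d) :
    lastUnit a (d + 1) = Matrix.of fun p => Matrix.vecCons 0 (lastUnit a d p) := by
  ext p q
  cases q using Fin.cases <;> simp [-Matrix.cons_val, lastUnit, hd.ne]

theorem lastUnit_succ_left {a d : ℕ} (ha : 0 < a) :
    lastUnit (a + 1) d = Matrix.of (Matrix.vecCons 0 fun p => lastUnit a d p) := by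
  ext p q
  cases p using Fin.cases <;> simp [-Matrix.cons_val, lastUnit, ha.ne]

/-- The indices after a block has been added in front of both parts. -/
def padBothIndex {n m a d : ℕ} :
    (Fin n ⊕ Fin m) ⊕ ((Fin a × Fin n) ⊕ (Fin d × Fin m)) →
      (Fin (a + 1) × Fin n) ⊕ (Fin (d + 1) × Fin m)
  | .inl (.inl x) => .inl (0, x)
  | .inl (.inr x) => .inr (0, x)
  | .inr (.inl p) => .inl (p.1.succ, p.2)
  | .inr (.inr p) => .inr (p.1.succ, p.2)

/-- The indices after a block has been added in front of the `D` part. -/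
def padDIndex {n m a d : ℕ} :
    Fin m ⊕ ((Fin a × Fin n) ⊕ (Fin d × Fin m)) → (Fin a × Fin n) ⊕ (Fin (d + 1) × Fin m)
  | .inl x => .inr (0, x)
  | .inr (.inl p) => .inl p
  | .inr (.inr p) => .inr (p.1.succ, p.2)

theorem padBothIndex_bijective {n m a d : ℕ} :
    Function.Bijective (padBothIndex (n := n) (m := m) (a := a) (d := d)) := by
  constructor
  · rintro ((x | x) | (⟨p, x⟩ | ⟨p, x⟩)) ((y | y) | (⟨q, y⟩ | ⟨q, y⟩)) <;>
      simp [-Matrix.cons_val, padBothIndex, Fin.succ_ne_zero, (Fin.succ_ne_zero _).symm]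
  · rintro (⟨p, x⟩ | ⟨p, x⟩) <;> cases p using Fin.cases with
    | zero => first | exact ⟨.inl (.inl x), rfl⟩ | exact ⟨.inl (.inr x), rfl⟩
    | succ p => first | exact ⟨.inr (.inl (p, x)), rfl⟩ | exact ⟨.inr (.inr (p, x)), rfl⟩

theorem padDIndex_bijective {n m a d : ℕ} :
    Function.Bijective (padDIndex (n := n) (m := m) (a := a) (d := d)) := by
  constructor
  · rintro (x | (⟨p, x⟩ | ⟨p, x⟩)) (y | (⟨q, y⟩ | ⟨q, y⟩)) <;>
      simp [-Matrix.cons_val, padDIndex, Fin.succ_ne_zero, (Fin.succ_ne_zero _).symm]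
  · rintro (⟨p, x⟩ | ⟨p, x⟩)
    · exact ⟨.inr (.inl (p, x)), rfl⟩
    · cases p using Fin.cases with
      | zero => exact ⟨.inl x, rfl⟩
      | succ p => exact ⟨.inr (.inr (p, x)), rfl⟩

theorem systemFiedler_padBoth {n m : ℕ} (A : ℕ → Matrix (Fin n) (Fin n) ℂ)
    (D : ℕ → Matrix (Fin m) (Fin m) ℂ) (B : Matrix (Fin n) (Fin m) ℂ)
    (C : Matrix (Fin m) (Fin n) ℂ) (a d i : ℕ) (ha : i < a) (hd : i < d) :
    (systemFiedler A D B C (a + 1) (d + 1) i).submatrix padBothIndex padBothIndex =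
      Matrix.fromBlocks 1 0 0 (systemFiedler A D B C a d i) := by
  unfold systemFiedler
  rw [lastUnit_succ_succ (by omega) (by omega), lastUnit_succ_succ (by omega) (by omega)]
  split_ifs with h₀
  · subst h₀
    rw [fiedlerMatrix_succ A ha, fiedlerMatrix_succ D hd]
    ext ((x | x) | (⟨p, x⟩ | ⟨p, x⟩)) ((y | y) | (⟨q, y⟩ | ⟨q, y⟩)) <;>
      simp [-Matrix.cons_val, padBothIndex, Matrix.one_apply]
  all_goals first | omega | skip
  rw [fiedlerMatrix_succ A ha, fiedlerMatrix_succ D hd]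
  ext ((x | x) | (⟨p, x⟩ | ⟨p, x⟩)) ((y | y) | (⟨q, y⟩ | ⟨q, y⟩)) <;>
    simp [-Matrix.cons_val, padBothIndex, Matrix.one_apply]

theorem systemFiedler_padD {n m : ℕ} (A : ℕ → Matrix (Fin n) (Fin n) ℂ)
    (D : ℕ → Matrix (Fin m) (Fin m) ℂ) (B : Matrix (Fin n) (Fin m) ℂ)
    (C : Matrix (Fin m) (Fin n) ℂ) (a d i : ℕ) (hd : i < d) :
    (systemFiedler A D B C a (d + 1) i).submatrix padDIndex padDIndex =
      Matrix.fromBlocks 1 0 0 (systemFiedler A D B C a d i) := by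
  unfold systemFiedler
  rw [lastUnit_succ_left (by omega), lastUnit_succ_right (by omega)]
  rw [fiedlerMatrix_succ D hd, if_pos (show i < d + 1 by omega), if_pos hd]
  split_ifs with h₀
  · subst h₀
    rw [fiedlerMatrix_succ D hd]
    ext (x | (⟨p, x⟩ | ⟨p, x⟩)) (y | (⟨q, y⟩ | ⟨q, y⟩)) <;>
      simp [-Matrix.cons_val, padDIndex, Matrix.one_apply]
  all_goals
    ext (x | (⟨p, x⟩ | ⟨p, x⟩)) (y | (⟨q, y⟩ | ⟨q, y⟩)) <;>
      simp [-Matrix.cons_val, padDIndex, Matrix.one_apply]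

/-- Reindexing along a bijection and `M ↦ diag(1, M)` are both multiplicative, so a relation between
the factors passes to the products. -/
theorem orderedProd_submatrix {τ ι κ R : Type*} [Fintype τ] [Fintype ι] [Fintype κ]
    [DecidableEq τ] [DecidableEq ι] [DecidableEq κ] [CommRing R] (f : τ ⊕ ι → κ)
    (hf : Function.Bijective f) (M : ℕ → Matrix ι ι R) (N : ℕ → Matrix κ κ R) (c : ℕ → Prop)
    (k : ℕ) (h : ∀ j ≤ k, (N j).submatrix f f = Matrix.fromBlocks 1 0 0 (M j)) :
    (orderedProd N c k).submatrix f f = Matrix.fromBlocks 1 0 0 (orderedProd M c k) := by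
  induction k with
  | zero => exact h 0 le_rfl
  | succ k ih =>
    have ih' := ih fun j hj => h j (by omega)
    simp only [orderedProd]
    split_ifs
    all_goals
      rw [Matrix.submatrix_mul _ _ f f f hf, ih', h (k + 1) le_rfl, Matrix.fromBlocks_multiply]
      simp

/-- `diag(I, W)`. -/
def diagOne {k b : ℕ} (W : Matrix (Fin b) (Fin b) (Matrix (Fin k) (Fin k) ℂ)) :
    Matrix (Fin (b + 1)) (Fin (b + 1)) (Matrix (Fin k) (Fin k) ℂ) :=
  Matrix.of (Matrix.vecCons (Matrix.vecCons 1 0) fun p => Matrix.vecCons 0 (W p))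

/-- An identity block is added in front of both parts. -/
def BlockMatrix.padBoth {n m a d : ℕ} (W : BlockMatrix n m a d) :
    BlockMatrix n m (a + 1) (d + 1) where
  AA := diagOne W.AA
  AD := Matrix.of (Matrix.vecCons 0 fun p => Matrix.vecCons 0 (W.AD p))
  DA := Matrix.of (Matrix.vecCons 0 fun p => Matrix.vecCons 0 (W.DA p))
  DD := diagOne W.DD

/-- An identity block is added in front of the `D` part. -/
def BlockMatrix.padD {n m a d : ℕ} (W : BlockMatrix n m a d) : BlockMatrix n m a (d + 1) where
  AA := W.AA
  AD := Matrix.of fun p => Matrix.vecCons 0 (W.AD p)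
  DA := Matrix.of (Matrix.vecCons 0 fun p => W.DA p)
  DD := diagOne W.DD

theorem BlockMatrix.toMatrix_padBoth_submatrix {n m a d : ℕ} (W : BlockMatrix n m a d) :
    W.padBoth.toMatrix.submatrix padBothIndex padBothIndex =
      Matrix.fromBlocks 1 0 0 W.toMatrix := by
  ext ((x | x) | (⟨p, x⟩ | ⟨p, x⟩)) ((y | y) | (⟨q, y⟩ | ⟨q, y⟩)) <;>
    simp [-Matrix.cons_val, padBothIndex, Matrix.one_apply, BlockMatrix.padBoth, BlockMatrix.toMatrix,
      diagOne]

theorem BlockMatrix.toMatrix_padD_submatrix {n m a d : ℕ} (W : BlockMatrix n m a d) :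
    W.padD.toMatrix.submatrix padDIndex padDIndex = Matrix.fromBlocks 1 0 0 W.toMatrix := by
  ext (x | (⟨p, x⟩ | ⟨p, x⟩)) (y | (⟨q, y⟩ | ⟨q, y⟩)) <;>
    simp [-Matrix.cons_val, padDIndex, Matrix.one_apply, BlockMatrix.padD, BlockMatrix.toMatrix,
      diagOne]

theorem Matrix.eq_of_submatrix_eq {ι κ R : Type*} {f : ι → κ} (hf : Function.Surjective f)
    {M N : Matrix κ κ R} (h : M.submatrix f f = N.submatrix f f) : M = N := by
  ext x y
  obtain ⟨x, rfl⟩ := hf x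
  obtain ⟨y, rfl⟩ := hf y
  exact congrFun (congrFun h x) y

/-! ### Multiplication by the Fiedler matrix of largest index -/

theorem fiedlerMatrix_last {k b : ℕ} (P : ℕ → Matrix (Fin k) (Fin k) ℂ) :
    fiedlerMatrix (b + 2) P (b + 1) = Matrix.comp _ _ _ _ ℂ (Matrix.of
      (Matrix.vecCons (Matrix.vecCons (-P (b + 1)) (Matrix.vecCons 1 0))
        (Matrix.vecCons (Matrix.vecCons 1 0) fun p =>
          Matrix.vecCons 0 (Matrix.vecCons 0 ((1 : Matrix _ _ (Matrix _ _ ℂ)) p))))) := by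
  have h₁ : b + 1 ≠ 0 := by omega
  have h₂ : b + 1 ≠ b + 2 := by omega
  have h₃ : ∀ p, p + (b + 1) + 1 = b + 2 ↔ p = 0 := by omega
  have h₄ : ∀ p, p + (b + 1) = b + 2 ↔ p = 1 := by omega
  ext ⟨p, x⟩ ⟨q, y⟩
  simp only [fiedlerMatrix, Matrix.comp_apply, Matrix.of_apply, h₁, h₂, h₃, h₄, if_false]
  cases p using Fin.cases with
  | zero =>
    cases q using Fin.cases with
    | zero => rfl
    | succ q => cases q using Fin.cases <;> simp [-Matrix.cons_val, Fin.ext_iff]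
  | succ p =>
    cases p using Fin.cases with
    | zero =>
      cases q using Fin.cases with
      | zero => rfl
      | succ q => cases q using Fin.cases <;> simp [-Matrix.cons_val, Fin.ext_iff]
    | succ p =>
      cases q using Fin.cases with
      | zero => simp [-Matrix.cons_val, Fin.ext_iff]
      | succ q => cases q using Fin.cases <;> simp [-Matrix.cons_val, Fin.ext_iff, Matrix.one_apply]

/-- Only the first two block columns change, because the factor is the identity beyond its top left
corner. `G` may be rectangular, so that the off-diagonal parts are covered as well. -/
theorem comp_mul_fiedlerMatrix_last {l r k b : ℕ} (P : ℕ → Matrix (Fin k) (Fin k) ℂ)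
    (G : Matrix (Fin r) (Fin (b + 2)) (Matrix (Fin l) (Fin k) ℂ)) :
    Matrix.comp _ _ _ _ ℂ G * fiedlerMatrix (b + 2) P (b + 1) =
      Matrix.comp _ _ _ _ ℂ (Matrix.of fun p =>
        Matrix.vecCons (G p 0 * -P (b + 1) + G p 1)
          (Matrix.vecCons (G p 0) fun q => G p q.succ.succ)) := by
  rw [fiedlerMatrix_last]
  ext ⟨p, x⟩ ⟨q, y⟩
  simp only [Matrix.mul_apply, Fintype.sum_prod_type, Fin.sum_univ_succ, Matrix.comp_apply]
  cases q using Fin.cases with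
  | zero => simp [-Matrix.cons_val, Matrix.mul_apply, Matrix.one_apply]
  | succ q =>
    cases q using Fin.cases with
    | zero => simp [-Matrix.cons_val, Matrix.one_apply]
    | succ q =>
      simp only [Matrix.of_apply, Matrix.cons_val_succ, Matrix.cons_val_zero, Pi.zero_apply,
        Matrix.zero_apply, mul_zero, Finset.sum_const_zero, zero_add]
      rw [Finset.sum_eq_single q (fun j _ hj => by simp [-Matrix.cons_val, hj]) (by simp)]
      simp [-Matrix.cons_val, Matrix.one_apply]

theorem fiedlerMatrix_last_mul_comp {l r k b : ℕ} (P : ℕ → Matrix (Fin k) (Fin k) ℂ)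
    (G : Matrix (Fin (b + 2)) (Fin r) (Matrix (Fin k) (Fin l) ℂ)) :
    fiedlerMatrix (b + 2) P (b + 1) * Matrix.comp _ _ _ _ ℂ G =
      Matrix.comp _ _ _ _ ℂ (Matrix.of
        (Matrix.vecCons (fun q => -P (b + 1) * G 0 q + G 1 q)
          (Matrix.vecCons (G 0) fun p => G p.succ.succ))) := by
  rw [fiedlerMatrix_last]
  ext ⟨p, x⟩ ⟨q, y⟩
  simp only [Matrix.mul_apply, Fintype.sum_prod_type, Fin.sum_univ_succ, Matrix.comp_apply]
  cases p using Fin.cases with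
  | zero => simp [-Matrix.cons_val, Matrix.mul_apply, Matrix.one_apply]
  | succ p =>
    cases p using Fin.cases with
    | zero => simp [-Matrix.cons_val, Matrix.one_apply]
    | succ p =>
      simp only [Matrix.of_apply, Matrix.cons_val_succ, Matrix.cons_val_zero,
        Matrix.zero_apply, zero_mul, Finset.sum_const_zero, zero_add]
      rw [Finset.sum_eq_single p (fun j _ hj => by simp [-Matrix.cons_val, hj.symm]) (by simp)]
      simp [-Matrix.cons_val, Matrix.one_apply]

/-- Columnwise criterion; writing `Fin.succ 0` instead of `1` lets entries of `Matrix.vecCons` be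
evaluated by the successor rule. -/
theorem comp_mul_fiedlerMatrix_last_eq {l r k b : ℕ} (P : ℕ → Matrix (Fin k) (Fin k) ℂ)
    (G H : Matrix (Fin r) (Fin (b + 2)) (Matrix (Fin l) (Fin k) ℂ))
    (h₀ : ∀ p, H p 0 = G p 0 * -P (b + 1) + G p (Fin.succ 0)) (h₁ : ∀ p, H p (Fin.succ 0) = G p 0)
    (h₂ : ∀ p q, H p (Fin.succ (Fin.succ q)) = G p (Fin.succ (Fin.succ q))) :
    Matrix.comp _ _ _ _ ℂ H = Matrix.comp _ _ _ _ ℂ G * fiedlerMatrix (b + 2) P (b + 1) := by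
  rw [comp_mul_fiedlerMatrix_last]
  congr 1
  refine Matrix.ext fun p q => ?_
  cases q using Fin.cases with
  | zero => exact h₀ p
  | succ q =>
    cases q using Fin.cases with
    | zero => exact h₁ p
    | succ q => exact h₂ p q

theorem fiedlerMatrix_last_mul_comp_eq {l r k b : ℕ} (P : ℕ → Matrix (Fin k) (Fin k) ℂ)
    (G H : Matrix (Fin (b + 2)) (Fin r) (Matrix (Fin k) (Fin l) ℂ))
    (h₀ : ∀ q, H 0 q = -P (b + 1) * G 0 q + G (Fin.succ 0) q) (h₁ : ∀ q, H (Fin.succ 0) q = G 0 q)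
    (h₂ : ∀ p q, H (Fin.succ (Fin.succ p)) q = G (Fin.succ (Fin.succ p)) q) :
    Matrix.comp _ _ _ _ ℂ H = fiedlerMatrix (b + 2) P (b + 1) * Matrix.comp _ _ _ _ ℂ G := by
  rw [fiedlerMatrix_last_mul_comp]
  congr 1
  refine Matrix.ext fun p q => ?_
  cases p using Fin.cases with
  | zero => exact h₀ q
  | succ p =>
    cases p using Fin.cases with
    | zero => exact h₁ q
    | succ p => exact h₂ p q

theorem comp_bordered_consecution {k b : ℕ} (P : ℕ → Matrix (Fin k) (Fin k) ℂ)
    (W : Matrix (Fin (b + 1)) (Fin (b + 1)) (Matrix (Fin k) (Fin k) ℂ)) :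
    Matrix.comp _ _ _ _ ℂ (bordered_consecution (P (b + 1)) W) =
      Matrix.comp _ _ _ _ ℂ (diagOne W) * fiedlerMatrix (b + 2) P (b + 1) := by
  apply comp_mul_fiedlerMatrix_last_eq <;> intro p <;> cases p using Fin.cases <;>
    simp [-Matrix.cons_val, -Fin.succ_zero_eq_one, bordered_consecution, diagOne, insertSecond,
      Matrix.vecTail]

theorem comp_bordered_inversion {k b : ℕ} (P : ℕ → Matrix (Fin k) (Fin k) ℂ)
    (W : Matrix (Fin (b + 1)) (Fin (b + 1)) (Matrix (Fin k) (Fin k) ℂ)) :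
    Matrix.comp _ _ _ _ ℂ (bordered_inversion (P (b + 1)) W) =
      fiedlerMatrix (b + 2) P (b + 1) * Matrix.comp _ _ _ _ ℂ (diagOne W) := by
  apply fiedlerMatrix_last_mul_comp_eq
  on_goal 3 => intro p
  all_goals
    intro q
    cases q using Fin.cases <;>
      simp [-Matrix.cons_val, -Fin.succ_zero_eq_one, bordered_inversion, diagOne]

/-! ### A step of the algorithm as multiplication by one factor -/

section Step

variable {n m : ℕ} (A : ℕ → Matrix (Fin n) (Fin n) ℂ) (D : ℕ → Matrix (Fin m) (Fin m) ℂ)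
  (B : Matrix (Fin n) (Fin m) ℂ) (C : Matrix (Fin m) (Fin n) ℂ)

theorem systemFiedler_last_both (b : ℕ) :
    systemFiedler A D B C (b + 2) (b + 2) (b + 1) =
      Matrix.fromBlocks (fiedlerMatrix (b + 2) A (b + 1)) 0 0
        (fiedlerMatrix (b + 2) D (b + 1)) := by
  simp [systemFiedler]

/-- The index `b + 1` is no longer below `a`, so the `A` part has no factor left to contribute. -/
theorem systemFiedler_last_D {a b : ℕ} (h : a ≤ b + 1) :
    systemFiedler A D B C a (b + 2) (b + 1) =
      Matrix.fromBlocks 1 0 0 (fiedlerMatrix (b + 2) D (b + 1)) := by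
  simp [systemFiedler, h]

theorem BlockMatrix.toMatrix_bothConsecution {b : ℕ} (W : BlockMatrix n m (b + 1) (b + 1)) :
    (W.bothConsecution (A (b + 1)) (D (b + 1))).toMatrix =
      W.padBoth.toMatrix * systemFiedler A D B C (b + 2) (b + 2) (b + 1) := by
  rw [systemFiedler_last_both]
  unfold BlockMatrix.toMatrix
  rw [Matrix.fromBlocks_multiply]
  simp only [Matrix.mul_zero, add_zero, zero_add, BlockMatrix.bothConsecution, BlockMatrix.padBoth]
  rw [comp_bordered_consecution, comp_bordered_consecution]
  congr 1 <;> apply comp_mul_fiedlerMatrix_last_eq <;> intro p <;> cases p using Fin.cases <;>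
    simp [-Matrix.cons_val, -Fin.succ_zero_eq_one, insertSecond, Matrix.vecTail]

theorem BlockMatrix.toMatrix_bothInversion {b : ℕ} (W : BlockMatrix n m (b + 1) (b + 1)) :
    (W.bothInversion (A (b + 1)) (D (b + 1))).toMatrix =
      systemFiedler A D B C (b + 2) (b + 2) (b + 1) * W.padBoth.toMatrix := by
  rw [systemFiedler_last_both]
  unfold BlockMatrix.toMatrix
  rw [Matrix.fromBlocks_multiply]
  simp only [Matrix.zero_mul, add_zero, zero_add, BlockMatrix.bothInversion, BlockMatrix.padBoth]
  rw [comp_bordered_inversion, comp_bordered_inversion]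
  congr 1 <;> apply fiedlerMatrix_last_mul_comp_eq
  on_goal 3 => intro p
  on_goal 6 => intro p
  all_goals
    intro q
    cases q using Fin.cases <;>
      simp [-Matrix.cons_val, -Fin.succ_zero_eq_one, insertSecond, Matrix.vecTail]

theorem BlockMatrix.toMatrix_onlyDConsecution {a b : ℕ} (h : a ≤ b + 1)
    (W : BlockMatrix n m a (b + 1)) :
    (W.onlyDConsecution (D (b + 1))).toMatrix =
      W.padD.toMatrix * systemFiedler A D B C a (b + 2) (b + 1) := by
  rw [systemFiedler_last_D A D B C h]
  unfold BlockMatrix.toMatrix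
  rw [Matrix.fromBlocks_multiply]
  simp only [Matrix.mul_zero, add_zero, zero_add, Matrix.mul_one, BlockMatrix.onlyDConsecution,
    BlockMatrix.padD]
  rw [comp_bordered_consecution]
  congr 1
  apply comp_mul_fiedlerMatrix_last_eq <;> intro p <;>
    simp [-Matrix.cons_val, -Fin.succ_zero_eq_one, insertSecond, Matrix.vecTail]

theorem BlockMatrix.toMatrix_onlyDInversion {a b : ℕ} (h : a ≤ b + 1)
    (W : BlockMatrix n m a (b + 1)) :
    (W.onlyDInversion (D (b + 1))).toMatrix =
      systemFiedler A D B C a (b + 2) (b + 1) * W.padD.toMatrix := by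
  rw [systemFiedler_last_D A D B C h]
  unfold BlockMatrix.toMatrix
  rw [Matrix.fromBlocks_multiply]
  simp only [Matrix.zero_mul, add_zero, zero_add, Matrix.one_mul, BlockMatrix.onlyDInversion,
    BlockMatrix.padD]
  rw [comp_bordered_inversion]
  congr 1
  apply fiedlerMatrix_last_mul_comp_eq
  on_goal 3 => intro p
  all_goals
    intro q
    simp [-Matrix.cons_val, -Fin.succ_zero_eq_one, insertSecond, Matrix.vecTail]
  rfl

open Classical in
-- Inductive step of the first phase: padding turns the old partial product into the same product
-- for the larger system, and bordering supplies the missing factor.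
theorem BlockMatrix.toMatrix_both_step (c : ℕ → Prop) {b : ℕ} (W : BlockMatrix n m (b + 1) (b + 1))
    (hW : W.toMatrix = orderedProd (systemFiedler A D B C (b + 1) (b + 1)) c b) :
    (if c b then W.bothConsecution (A (b + 1)) (D (b + 1))
      else W.bothInversion (A (b + 1)) (D (b + 1))).toMatrix =
      orderedProd (systemFiedler A D B C (b + 2) (b + 2)) c (b + 1) := by
  have hpad : W.padBoth.toMatrix = orderedProd (systemFiedler A D B C (b + 2) (b + 2)) c b := by
    apply Matrix.eq_of_submatrix_eq padBothIndex_bijective.surjective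
    rw [W.toMatrix_padBoth_submatrix, hW]
    refine (orderedProd_submatrix _ padBothIndex_bijective _ _ c b fun j hj => ?_).symm
    exact systemFiedler_padBoth A D B C _ _ j (by omega) (by omega)
  simp only [orderedProd]
  rw [← hpad]
  split_ifs
  · exact W.toMatrix_bothConsecution A D B C
  · exact W.toMatrix_bothInversion A D B C

open Classical in
theorem BlockMatrix.toMatrix_onlyD_step (c : ℕ → Prop) {a b : ℕ} (h : a ≤ b + 1)
    (W : BlockMatrix n m a (b + 1))
    (hW : W.toMatrix = orderedProd (systemFiedler A D B C a (b + 1)) c b) :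
    (if c b then W.onlyDConsecution (D (b + 1)) else W.onlyDInversion (D (b + 1))).toMatrix =
      orderedProd (systemFiedler A D B C a (b + 2)) c (b + 1) := by
  have hpad : W.padD.toMatrix = orderedProd (systemFiedler A D B C a (b + 2)) c b := by
    apply Matrix.eq_of_submatrix_eq padDIndex_bijective.surjective
    rw [W.toMatrix_padD_submatrix, hW]
    refine (orderedProd_submatrix _ padDIndex_bijective _ _ c b fun j hj => ?_).symm
    exact systemFiedler_padD A D B C _ _ j (by omega)
  simp only [orderedProd]
  rw [← hpad]
  split_ifs
  · exact W.toMatrix_onlyDConsecution A D B C h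
  · exact W.toMatrix_onlyDInversion A D B C h

/-- The partitioned matrix `[-A_0, B; -C, -D_0]`. -/
def constantBlocks : BlockMatrix n m 1 1 where
  AA := Matrix.of fun _ _ => -A 0
  AD := Matrix.of fun _ _ => B
  DA := Matrix.of fun _ _ => -C
  DD := Matrix.of fun _ _ => -D 0

theorem toMatrix_constantBlocks :
    (constantBlocks A D B C).toMatrix = systemFiedler A D B C 1 1 0 := by
  ext (⟨p, x⟩ | ⟨p, x⟩) (⟨q, y⟩ | ⟨q, y⟩) <;>
    simp [constantBlocks, BlockMatrix.toMatrix, systemFiedler, fiedlerMatrix, lastUnit,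
      Subsingleton.elim p 0, Subsingleton.elim q 0]

end Step

/-! ### The algorithm computes partial products -/

/-- The start matrix is itself the result of a first-phase step, applied to the single factor of
index `0`, so the base case needs no separate computation. -/
theorem SystemPolynomial.startConsecution_eq {n m dA dD : ℕ} (S : SystemPolynomial n m dA dD) :
    S.startConsecution = (constantBlocks S.A.coeff S.D.coeff S.B S.C).bothConsecution
      (S.A.coeff 1) (S.D.coeff 1) := by
  simp only [SystemPolynomial.startConsecution, BlockMatrix.bothConsecution, constantBlocks,
    BlockMatrix.mk.injEq]
  refine ⟨?_, ?_, ?_, ?_⟩ <;> refine Matrix.ext fun p q => ?_ <;> fin_cases p <;> fin_cases q <;>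
    rfl

theorem SystemPolynomial.startInversion_eq {n m dA dD : ℕ} (S : SystemPolynomial n m dA dD) :
    S.startInversion = (constantBlocks S.A.coeff S.D.coeff S.B S.C).bothInversion
      (S.A.coeff 1) (S.D.coeff 1) := by
  simp only [SystemPolynomial.startInversion, BlockMatrix.bothInversion, constantBlocks,
    BlockMatrix.mk.injEq]
  refine ⟨?_, ?_, ?_, ?_⟩ <;> refine Matrix.ext fun p q => ?_ <;> fin_cases p <;> fin_cases q <;>
    rfl

theorem SystemPolynomial.algorithm_both {n m dA dD : ℕ} (S : SystemPolynomial n m dA dD)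
    (σ : Equiv.Perm (Fin dD)) (i : ℕ) (hi : i + 2 ≤ dA) :
    ∃ W : BlockMatrix n m (i + 2) (i + 2), S.algorithm σ i = ⟨i + 2, i + 2, W⟩ ∧
      W.toMatrix = orderedProd (systemFiedler S.A.coeff S.D.coeff S.B S.C (i + 2) (i + 2))
        (HasConsecution σ) (i + 1) := by
  induction i with
  | zero =>
    refine ⟨_, rfl, ?_⟩
    rw [S.startConsecution_eq, S.startInversion_eq]
    exact BlockMatrix.toMatrix_both_step S.A.coeff S.D.coeff S.B S.C _ _
      (toMatrix_constantBlocks _ _ _ _)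
  | succ i ih =>
    obtain ⟨W, hW, hWp⟩ := ih (by omega)
    refine ⟨_, ?_, BlockMatrix.toMatrix_both_step S.A.coeff S.D.coeff S.B S.C _ W hWp⟩
    simp only [SystemPolynomial.algorithm]
    rw [if_pos hi, hW]
    rfl

theorem SystemPolynomial.algorithm_onlyD {n m dA dD : ℕ} (hA : 2 ≤ dA)
    (S : SystemPolynomial n m dA dD) (σ : Equiv.Perm (Fin dD)) (i : ℕ) (hi : dA ≤ i + 2) :
    ∃ W : BlockMatrix n m dA (i + 2), S.algorithm σ i = ⟨dA, i + 2, W⟩ ∧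
      W.toMatrix = orderedProd (systemFiedler S.A.coeff S.D.coeff S.B S.C dA (i + 2))
        (HasConsecution σ) (i + 1) := by
  -- `e` is the index at which the `A` part reaches full size; there the first-phase invariant
  -- starts the induction.
  obtain ⟨e, rfl⟩ : ∃ e, dA = e + 2 := ⟨dA - 2, by omega⟩
  replace hi : e ≤ i := by omega
  induction i, hi using Nat.le_induction with
  | base => exact S.algorithm_both σ e le_rfl
  | succ i hi ih =>
    obtain ⟨W, hW, hWp⟩ := ih
    refine ⟨_, ?_, BlockMatrix.toMatrix_onlyD_step S.A.coeff S.D.coeff S.B S.C _ (by omega) W hWp⟩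
    simp only [SystemPolynomial.algorithm]
    rw [if_neg (by omega), hW]
    rfl

/-! ### Inclusion of blocks in the next matrix -/

theorem bordered_consecution_succAbove {k b : ℕ} (P : Matrix (Fin k) (Fin k) ℂ)
    (W : Matrix (Fin (b + 1)) (Fin (b + 1)) (Matrix (Fin k) (Fin k) ℂ)) (p q : Fin (b + 1)) :
    bordered_consecution P W p.succ (Fin.succAbove (Fin.succ 0) q) = W p q := by
  cases q using Fin.cases <;> rfl

theorem insertSecond_succAbove {α : Type} {k : ℕ} (x : α) (v : Fin (k + 1) → α) (q : Fin (k + 1)) :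
    insertSecond x v (Fin.succAbove (Fin.succ 0) q) = v q := by
  cases q using Fin.cases <;> rfl

theorem bordered_inversion_succAbove {k b : ℕ} (P : Matrix (Fin k) (Fin k) ℂ)
    (W : Matrix (Fin (b + 1)) (Fin (b + 1)) (Matrix (Fin k) (Fin k) ℂ)) (p q : Fin (b + 1)) :
    bordered_inversion P W (Fin.succAbove (Fin.succ 0) p) q.succ = W p q := by
  cases p using Fin.cases <;> rfl

theorem PartitionedMatrix.blocksIn_refl {n m : ℕ} (U : PartitionedMatrix n m) : U.BlocksIn U :=
  ⟨RelEmbedding.refl _, RelEmbedding.refl _, RelEmbedding.refl _, RelEmbedding.refl _,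
    fun _ _ => rfl, fun _ _ => rfl, fun _ _ => rfl, fun _ _ => rfl⟩

/-- The old matrix returns on deleting, in each part, the first block row and second block column
after a consecution, or the second block row and first block column after an inversion. Degenerate
partitions are left unchanged by the step. -/
theorem blocksIn_phaseOneStep {n m : ℕ} (P : Matrix (Fin n) (Fin n) ℂ)
    (Q : Matrix (Fin m) (Fin m) ℂ) (c : Prop) (U : PartitionedMatrix n m) :
    U.BlocksIn (phaseOneStep P Q c U) := by
  obtain ⟨_ | a, _ | d, W⟩ := U
  · exact PartitionedMatrix.blocksIn_refl _
  · exact PartitionedMatrix.blocksIn_refl _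
  · exact PartitionedMatrix.blocksIn_refl _
  · by_cases hc : c <;> simp only [phaseOneStep, hc, if_true, if_false]
    · refine ⟨Fin.succOrderEmb _, Fin.succAboveOrderEmb (Fin.succ 0), Fin.succOrderEmb _,
        Fin.succAboveOrderEmb (Fin.succ 0), fun p q => ?_, fun p q => ?_, fun p q => ?_,
        fun p q => ?_⟩
      · exact (bordered_consecution_succAbove _ _ p q).symm
      · exact (insertSecond_succAbove 0 (W.AD p) q).symm
      · exact (insertSecond_succAbove 0 (W.DA p) q).symm
      · exact (bordered_consecution_succAbove _ _ p q).symm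
    · refine ⟨Fin.succAboveOrderEmb (Fin.succ 0), Fin.succOrderEmb _,
        Fin.succAboveOrderEmb (Fin.succ 0), Fin.succOrderEmb _, fun p q => ?_, fun p q => ?_,
        fun p q => ?_, fun p q => ?_⟩
      · exact (bordered_inversion_succAbove _ _ p q).symm
      · exact (congrFun (insertSecond_succAbove 0 (fun p => Matrix.vecCons 0 (W.AD p)) p)
          q.succ).symm
      · exact (congrFun (insertSecond_succAbove 0 (fun p => Matrix.vecCons 0 (W.DA p)) p)
          q.succ).symm
      · exact (bordered_inversion_succAbove _ _ p q).symm

theorem blocksIn_phaseTwoStep {n m : ℕ} (Q : Matrix (Fin m) (Fin m) ℂ) (c : Prop)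
    (U : PartitionedMatrix n m) : U.BlocksIn (phaseTwoStep Q c U) := by
  obtain ⟨a, _ | d, W⟩ := U
  · exact PartitionedMatrix.blocksIn_refl _
  · by_cases hc : c <;> simp only [phaseTwoStep, hc, if_true, if_false]
    · refine ⟨RelEmbedding.refl _, RelEmbedding.refl _, Fin.succOrderEmb _,
        Fin.succAboveOrderEmb (Fin.succ 0), fun p q => rfl, fun p q => ?_, fun p q => rfl,
        fun p q => ?_⟩
      · exact (insertSecond_succAbove 0 (W.AD p) q).symm
      · exact (bordered_consecution_succAbove _ _ p q).symm
    · refine ⟨RelEmbedding.refl _, RelEmbedding.refl _, Fin.succAboveOrderEmb (Fin.succ 0),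
        Fin.succOrderEmb _, fun p q => rfl, fun p q => rfl, fun p q => ?_, fun p q => ?_⟩
      · exact (congrFun (insertSecond_succAbove 0 W.DA p) q).symm
      · exact (bordered_inversion_succAbove _ _ p q).symm

end

theorem mainTheorem5 {n m dA dD : ℕ} (hA : 2 ≤ dA) (hAD : dA < dD)
    (S : SystemPolynomial n m dA dD) (σ : Equiv.Perm (Fin dD)) :
    (∀ i ≤ dD - 2, (S.algorithm σ i).a = min (i + 2) dA ∧ (S.algorithm σ i).d = i + 2) ∧
    (∀ i, 1 ≤ i → i ≤ dD - 2 → (S.algorithm σ (i - 1)).BlocksIn (S.algorithm σ i)) ∧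
    ∃ W : BlockMatrix n m dA dD,
      S.algorithm σ (dD - 2) = ⟨dA, dD, W⟩ ∧ W.toMatrix = S.fiedlerProduct σ := by
  refine ⟨fun i _ => ?_, fun i h₁ _ => ?_, ?_⟩
  · rcases le_total (i + 2) dA with h | h
    · obtain ⟨W, hW, -⟩ := S.algorithm_both σ i h
      rw [hW]
      exact ⟨(min_eq_left h).symm, rfl⟩
    · obtain ⟨W, hW, -⟩ := S.algorithm_onlyD hA σ i h
      rw [hW]
      exact ⟨(min_eq_right h).symm, rfl⟩
  · obtain ⟨j, rfl⟩ : ∃ j, i = j + 1 := ⟨i - 1, by omega⟩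
    simp only [Nat.add_sub_cancel, SystemPolynomial.algorithm]
    split_ifs
    · exact blocksIn_phaseOneStep _ _ _ _
    · exact blocksIn_phaseTwoStep _ _ _
  -- At the last index the truncated system has full size, so the partial product is the whole
  -- Fiedler product.
  · obtain ⟨e, rfl⟩ : ∃ e, dD = e + 2 := ⟨dD - 2, by omega⟩
    obtain ⟨W, hW, hWp⟩ := S.algorithm_onlyD hA σ e hAD.le
    exact ⟨W, hW, hWp.trans (S.fiedlerProduct_eq_orderedProd hAD σ).symm⟩
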